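/- For a finite simple graph $G$, let $F(G)$ (the core index of $G$) denote the number of connected subgraphs of $G$, i.e. of connected graphs with nonempty vertex set $V' \subseteq V(G)$ and edge set $E' \subseteq E(G)$. A graph is called unicyclic if it is connected and has as many edges as vertices. Let $C_n$ be the cycle on $n$ vertices and, for $n \ge 4$, let $U^l_{n,3}$ be the lollipop graph on $n$ vertices obtained by identifying one vertex of a triangle with an end vertex of a path on $n-2$ vertices; both are unicyclic graphs on $n$ vertices. **Theorem 4.9.** Let $n \ge 4$ and let $G$ be a unicyclic graph on $n$ vertices. 1. If $n \ge 7$, then $F(G) \ge F(U^l_{n,3})$, with equality if and only if $G \cong U^l_{n,3}$. 2. If $n \le 5$, then $F(G) \ge F(C_n)$, with equality if and only if $G \cong C_n$. 3. If $n = 6$, then $F(G) \ge F(C_6) = F(U^l_{6,3})$, with equality if and only if $G \cong C_6$ or $G \cong U^l_{6,3}$. -/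

import Mathlib

universe u

namespace CoreIndex

/-- The core index `F(G)`: the number of connected subgraphs of `G`, i.e. of pairs (nonempty vertex
set, set of edges of `G` between those vertices) that form a connected graph. For a disconnected
graph this is the sum of the core indices of the connected components. -/
noncomputable def coreIndex {V : Type*} (G : SimpleGraph V) : ℕ :=
  {H : G.Subgraph | H.Connected}.ncard

/-- A finite graph is unicyclic if it is connected and has as many edges as vertices. -/
def IsUnicyclic {V : Type*} [Fintype V] (G : SimpleGraph V) : Prop :=
  G.Connected ∧ G.edgeSet.ncard = Fintype.card V

/-- The lollipop graph `U^l_{n,g}`, for `3 ≤ g < n`: the vertices `0, 1, …, g - 1` form a cycle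
of length `g`, in this cyclic order, and the path `g - 1, g, …, n - 1` on `n - g + 1` vertices is
attached at the vertex `g - 1` of that cycle. -/
def lollipop (n g : ℕ) : SimpleGraph (Fin n) :=
  SimpleGraph.fromRel fun i j : Fin n =>
    (i : ℕ) + 1 = (j : ℕ) ∨ ((i : ℕ) = 0 ∧ (j : ℕ) + 1 = g)

end CoreIndex

/-! A unicyclic graph is a cycle to which leaves are attached one after the other
(`isUnicyclic_iff`). Attaching a leaf `v` at `w` to `K` gives `F(K) + F_w(K) + 1` connected
subgraphs, where `F_w` counts those containing `w` (`ncard_connectedSubgraphs_attach`). A lower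
bound for `F` thus follows from one for `F_w`.

On `n` vertices `F_x ≥ n + 4`, with equality only for a lollipop whose tail ends at `x`
(`IsUnicyclicSub.le_ncard_at`): a triangle gives 7, a new leaf has one more than its neighbour, and
every old vertex gains at least 2. Summing the increments, every non-cycle has `2F ≥ n ^ 2 + 9 * n -
16`, with equality only for the lollipop (`IsUnicyclicSub.cycle_or_le_ncard`).

The cycle has `F = n ^ 2 + 1`: itself and an arc for each starting point and each length below `n`.
Twice the difference between cycle and lollipop is `(n - 3) * (n - 6)`, whose sign separates the
three cases. -/

namespace CoreIndex

open SimpleGraph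

variable {V : Type*} {G : SimpleGraph V}

/-! ### Connectedness through adjacency-closed sets -/

/-- A connected subgraph is contained in every adjacency-closed set that it meets. -/
lemma verts_subset_of_closed {H : G.Subgraph} (hH : H.Connected) {S : Set V} {a : V}
    (haH : a ∈ H.verts) (ha : a ∈ S) (hS : ∀ x y, x ∈ S → H.Adj x y → y ∈ S) : H.verts ⊆ S := by
  intro y hy
  obtain ⟨p⟩ := hH ⟨a, haH⟩ ⟨y, hy⟩
  have key : ∀ {u v : H.verts}, H.coe.Walk u v → (u : V) ∈ S → (v : V) ∈ S := by
    intro u v p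
    induction p with
    | nil => exact id
    | cons h _ ih => exact fun hu => ih (hS _ _ hu h)
  exact key p ha

/-- Apply the hypothesis to the set of vertices reachable from `a`. With the converse above,
connectedness can be transferred between subgraphs without handling walks. -/
lemma connected_of_closed {H : G.Subgraph} {a : V} (haH : a ∈ H.verts)
    (h : ∀ S : Set V, a ∈ S → (∀ x y, x ∈ S → H.Adj x y → y ∈ S) → H.verts ⊆ S) :
    H.Connected := by
  rw [Subgraph.connected_iff', connected_iff_exists_forall_reachable]
  refine ⟨⟨a, haH⟩, ?_⟩
  have := h {y | ∃ hy : y ∈ H.verts, H.coe.Reachable ⟨a, haH⟩ ⟨y, hy⟩} ⟨haH, Reachable.refl _⟩ (by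
    rintro x y ⟨hx, hr⟩ hxy
    refine ⟨H.edge_vert hxy.symm, hr.trans ?_⟩
    exact Adj.reachable (by exact hxy))
  rintro ⟨y, hy⟩
  exact (this hy).2

/-- The connected subgraphs of a subgraph. -/
def connectedSubgraphs (K : G.Subgraph) : Set G.Subgraph := {H | H ≤ K ∧ H.Connected}

/-- The connected subgraphs of a subgraph that contain a given vertex. -/
def connectedSubgraphsAt (K : G.Subgraph) (x : V) : Set G.Subgraph :=
  {H | H ≤ K ∧ H.Connected ∧ x ∈ H.verts}

/-! ### Connected subgraphs of a cycle -/

/-- `K` is the cycle of length `n` traversed by `f`. -/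
structure IsCycleMap (n : ℕ) (K : G.Subgraph) (f : ZMod n → V) : Prop where
  three_le : 3 ≤ n
  injective : Function.Injective f
  verts_eq : K.verts = Set.range f
  adj_iff : ∀ x y, K.Adj x y ↔ ∃ i, (x = f i ∧ y = f (i + 1)) ∨ (y = f i ∧ x = f (i + 1))

/-- The path with `k` edges that starts at `f i` and follows `f`. -/
def arc {n : ℕ} {f : ZMod n → V} (hf : ∀ i, G.Adj (f i) (f (i + 1))) (i : ZMod n) (k : ℕ) :
    G.Subgraph where
  verts := {x | ∃ j ≤ k, x = f (i + j)}
  Adj x y := ∃ j < k, (x = f (i + j) ∧ y = f (i + j + 1)) ∨ (y = f (i + j) ∧ x = f (i + j + 1))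
  adj_sub := by
    rintro x y ⟨j, -, ⟨rfl, rfl⟩ | ⟨rfl, rfl⟩⟩
    · exact hf _
    · exact (hf _).symm
  edge_vert := by
    rintro x y ⟨j, hj, ⟨rfl, rfl⟩ | ⟨rfl, rfl⟩⟩
    · exact ⟨j, hj.le, rfl⟩
    · exact ⟨j + 1, hj, by push_cast; rw [add_assoc]⟩
  symm := ⟨by
    rintro x y ⟨j, hj, h⟩
    exact ⟨j, hj, h.symm⟩⟩

lemma natCast_inj_of_lt {n a b : ℕ} (ha : a < n) (hb : b < n) (h : (a : ZMod n) = b) : a = b := by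
  rw [ZMod.natCast_eq_natCast_iff'] at h
  rwa [Nat.mod_eq_of_lt ha, Nat.mod_eq_of_lt hb] at h

namespace IsCycleMap

variable {n : ℕ} {K : G.Subgraph} {f : ZMod n → V}

lemma adj_succ (h : IsCycleMap n K f) (i : ZMod n) : K.Adj (f i) (f (i + 1)) :=
  (h.adj_iff _ _).2 ⟨i, .inl ⟨rfl, rfl⟩⟩

lemma ambient_adj (h : IsCycleMap n K f) (i : ZMod n) : G.Adj (f i) (f (i + 1)) :=
  (h.adj_succ i).adj_sub

lemma arc_connected (hf : ∀ i, G.Adj (f i) (f (i + 1))) (i : ZMod n) (k : ℕ) :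
    (arc hf i k).Connected := by
  refine connected_of_closed (a := f i) ⟨0, by simp⟩ fun S hS hcl => ?_
  rintro x ⟨j, hj, rfl⟩
  induction j with
  | zero => simpa using hS
  | succ j ih =>
    refine hcl _ _ (ih (by omega)) ⟨j, by omega, .inl ⟨rfl, ?_⟩⟩
    push_cast; rw [add_assoc]

lemma arc_le (h : IsCycleMap n K f) (i : ZMod n) (k : ℕ) : arc h.ambient_adj i k ≤ K := by
  refine ⟨?_, ?_⟩
  · rintro x ⟨j, -, rfl⟩
    rw [h.verts_eq]; exact ⟨_, rfl⟩
  · rintro x y ⟨j, -, hxy⟩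
    exact (h.adj_iff _ _).2 ⟨_, hxy⟩

/-- The missing edge into `f i` marks the start of the arc; this tells arcs apart from each other
and from the whole cycle. -/
lemma not_arc_adj (h : IsCycleMap n K f) (i : ZMod n) {k : ℕ} (hk : k < n) :
    ¬ (arc h.ambient_adj i k).Adj (f (i - 1)) (f i) := by
  have h3 := h.three_le
  rintro ⟨j, hj, ⟨h1, h2⟩ | ⟨h1, h2⟩⟩
  · have h2 := h.injective h2
    have : ((j + 1 : ℕ) : ZMod n) = (0 : ℕ) := by
      push_cast; linear_combination -h2
    have := natCast_inj_of_lt (by omega) (by omega) this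
    omega
  -- The reversed match of endpoints would force `2 = 0` in `ZMod n`, impossible for `n ≥ 3`.
  · have h2 := h.injective h2
    have h1 := h.injective h1
    have : ((2 : ℕ) : ZMod n) = (0 : ℕ) := by
      push_cast; linear_combination h1 - h2
    have := natCast_inj_of_lt (by omega) (by omega) this
    omega

lemma arc_injective (h : IsCycleMap n K f) {i i' : ZMod n} {k k' : ℕ} (hk : k < n) (hk' : k' < n)
    (heq : arc h.ambient_adj i k = arc h.ambient_adj i' k') : i = i' ∧ k = k' := by
  have hi : i = i' := by
    have hm : f i' ∈ (arc h.ambient_adj i k).verts := by rw [heq]; exact ⟨0, by simp⟩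
    obtain ⟨j, hj, hij⟩ := hm
    have hij := h.injective hij
    rcases j with _ | j
    · simpa using hij.symm
    · exfalso
      apply h.not_arc_adj i' hk'
      rw [← heq]
      refine ⟨j, by omega, .inl ⟨?_, ?_⟩⟩ <;> rw [hij] <;> congr 1 <;> push_cast <;> ring
  refine ⟨hi, ?_⟩
  subst hi
  have key : ∀ {k k' : ℕ}, k < n → k' < n →
      arc h.ambient_adj i k = arc h.ambient_adj i k' → k' ≤ k := by
    intro k k' hk hk' heq
    have hm : f (i + k') ∈ (arc h.ambient_adj i k).verts := by rw [heq]; exact ⟨k', le_rfl, rfl⟩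
    obtain ⟨j, hj, hij⟩ := hm
    have := natCast_inj_of_lt hk' (by omega) (add_left_cancel (h.injective hij))
    omega
  exact le_antisymm (key hk' hk heq.symm) (key hk hk' heq)

lemma ne_arc (h : IsCycleMap n K f) (i : ZMod n) {k : ℕ} (hk : k < n) :
    K ≠ arc h.ambient_adj i k := by
  intro heq
  apply h.not_arc_adj i hk
  rw [← heq]
  simpa using h.adj_succ (i - 1)

lemma verts_arc_pred (h : IsCycleMap n K f) (i : ZMod n) :
    (arc h.ambient_adj i (n - 1)).verts = K.verts := by
  have h3 := h.three_le
  have : NeZero n := ⟨by omega⟩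
  refine Set.Subset.antisymm (h.arc_le _ _).1 ?_
  rw [h.verts_eq]
  rintro _ ⟨t, rfl⟩
  refine ⟨(t - i).val, by have := (t - i).val_lt; omega, ?_⟩
  rw [ZMod.natCast_zmod_val]; congr 1; ring

lemma connected (h : IsCycleMap n K f) : K.Connected :=
  (arc_connected h.ambient_adj 0 (n - 1)).mono (h.arc_le _ _) (h.verts_arc_pred 0)

/-- Some vertex `f i` of `H` lacks the edge coming into it: otherwise walking backwards around the
cycle shows `H = K`. From `f i`, follow the edges of `H` forwards up to the first gap. -/
lemma eq_arc_of_connected (h : IsCycleMap n K f) {H : G.Subgraph} (hle : H ≤ K)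
    (hH : H.Connected) (hne : H ≠ K) : ∃ i, ∃ k < n, H = arc h.ambient_adj i k := by
  classical
  have h3 := h.three_le
  obtain ⟨i, hi, hadj⟩ : ∃ i, f i ∈ H.verts ∧ ¬ H.Adj (f (i - 1)) (f i) := by
    by_contra! hcon
    obtain ⟨a, ha⟩ := hH.nonempty
    have ha' := hle.1 ha
    rw [h.verts_eq] at ha'
    obtain ⟨t, rfl⟩ := ha'
    have hall : ∀ j : ℕ, f (t - j) ∈ H.verts := by
      intro j
      induction j with
      | zero => simpa using ha
      | succ j ih =>
        have := H.edge_vert (hcon _ ih)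
        convert this using 2
        push_cast; ring
    have hall' : ∀ s, f s ∈ H.verts := by
      intro s
      have : NeZero n := ⟨by omega⟩
      have := hall (t - s).val
      rw [ZMod.natCast_zmod_val] at this
      simpa using this
    apply hne
    refine le_antisymm hle ⟨?_, ?_⟩
    · rw [h.verts_eq]; rintro _ ⟨s, rfl⟩; exact hall' s
    · intro x y hxy
      obtain ⟨s, ⟨rfl, rfl⟩ | ⟨rfl, rfl⟩⟩ := (h.adj_iff _ _).1 hxy
      · simpa using hcon _ (hall' (s + 1))
      · simpa using (hcon _ (hall' (s + 1))).symm
  -- After `n - 1` steps the next edge is the one into `f i`, which is missing.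
  have hex : ∃ k : ℕ, ¬ H.Adj (f (i + k)) (f (i + k + 1)) := by
    refine ⟨n - 1, ?_⟩
    convert hadj using 3
    · rw [Nat.cast_sub (by omega)]; simp; ring
    · rw [Nat.cast_sub (by omega)]; simp
  obtain ⟨k, hk, hmin⟩ : ∃ k : ℕ, ¬ H.Adj (f (i + k)) (f (i + k + 1)) ∧
      ∀ j < k, H.Adj (f (i + j)) (f (i + j + 1)) :=
    ⟨Nat.find hex, Nat.find_spec hex, fun j hj => not_not.1 (Nat.find_min hex hj)⟩
  have hkn : k < n := by
    by_contra! hkn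
    apply hadj
    convert hmin (n - 1) (by omega) using 2
    · rw [Nat.cast_sub (by omega)]; simp; ring
    · rw [Nat.cast_sub (by omega)]; simp
  refine ⟨i, k, hkn, ?_⟩
  -- The only edges of `K` leaving the arc or closing it up are at its two ends, and `H` has
  -- neither.
  have hstep : ∀ x y, x ∈ (arc h.ambient_adj i k).verts → H.Adj x y →
      (arc h.ambient_adj i k).Adj x y := by
    rintro x y ⟨j, hj, rfl⟩ hxy
    obtain ⟨s, ⟨h1, rfl⟩ | ⟨rfl, h1⟩⟩ := (h.adj_iff _ _).1 (hle.2 hxy)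
    · have h1 := h.injective h1
      subst h1
      rcases hj.lt_or_eq with hj | rfl
      · exact ⟨j, hj, .inl ⟨rfl, rfl⟩⟩
      · exact absurd hxy hk
    · have h1 := h.injective h1
      rcases j with _ | j
      · exfalso
        apply hadj
        have hs : s = i - 1 := by rw [eq_sub_iff_add_eq, ← h1]; simp
        rw [hs] at hxy
        simpa using hxy.symm
      · have hs : s = i + j := by
          push_cast at h1; linear_combination -h1
        subst hs
        exact ⟨j, hj, .inr ⟨rfl, by rw [h1]⟩⟩
  have hverts : H.verts ⊆ (arc h.ambient_adj i k).verts :=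
    verts_subset_of_closed hH hi ⟨0, by simp⟩ fun x y hx hxy =>
      (arc h.ambient_adj i k).edge_vert (hstep x y hx hxy).symm
  have hle' : H ≤ arc h.ambient_adj i k :=
    ⟨hverts, fun x y hxy => hstep x y (hverts (H.edge_vert hxy)) hxy⟩
  refine le_antisymm hle' (And.intro ?_ ?_)
  · rintro x ⟨j, hj, rfl⟩
    rcases j with _ | j
    · simpa using hi
    · have := H.edge_vert (hmin j (by omega)).symm
      convert this using 2
      push_cast; ring
  · rintro x y ⟨j, hj, ⟨rfl, rfl⟩ | ⟨rfl, rfl⟩⟩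
    · exact hmin j hj
    · exact (hmin j hj).symm

/-- The arc with `p.1` edges that starts `p.2` steps before `f i`. -/
def arcBefore (h : IsCycleMap n K f) (i : ZMod n) (p : Σ _ : ℕ, ℕ) : G.Subgraph :=
  arc h.ambient_adj (i - p.2) p.1

lemma arcBefore_injOn (h : IsCycleMap n K f) (i : ZMod n) :
    Set.InjOn (h.arcBefore i) ((Finset.range n).sigma fun _ => Finset.range n) := by
  rintro ⟨k, t⟩ hp ⟨k', t'⟩ hp' heq
  simp only [Finset.coe_sigma, Set.mem_sigma_iff, Finset.coe_range, Set.mem_Iio] at hp hp'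
  obtain ⟨h1, rfl⟩ := h.arc_injective hp.1 hp'.1 heq
  have := natCast_inj_of_lt hp.2 hp'.2 (sub_right_injective h1)
  rw [this]

lemma connectedSubgraphs_eq (h : IsCycleMap n K f) (i : ZMod n) :
    connectedSubgraphs K =
      insert K (h.arcBefore i '' ((Finset.range n).sigma fun _ => Finset.range n)) := by
  have h3 := h.three_le
  have : NeZero n := ⟨by omega⟩
  ext H
  constructor
  · rintro ⟨hle, hH⟩
    by_cases hne : H = K
    · exact .inl hne
    obtain ⟨s, k, hk, rfl⟩ := h.eq_arc_of_connected hle hH hne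
    refine .inr ⟨⟨k, (i - s).val⟩, ?_, ?_⟩
    · simpa using ⟨hk, (i - s).val_lt⟩
    · simp [arcBefore]
  · rintro (rfl | ⟨p, -, rfl⟩)
    · exact ⟨le_rfl, h.connected⟩
    · exact ⟨h.arc_le _ _, arc_connected _ _ _⟩

/-- Indexing an arc by its number `k` of edges and by how many steps `t < n` before `f i` it starts,
it contains `f i` exactly when `t ≤ k`. -/
lemma connectedSubgraphsAt_eq (h : IsCycleMap n K f) (i : ZMod n) :
    connectedSubgraphsAt K (f i) =
      insert K (h.arcBefore i '' ((Finset.range n).sigma fun k => Finset.range (k + 1))) := by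
  have h3 := h.three_le
  ext H
  have hcs : H ∈ connectedSubgraphsAt K (f i) ↔ H ∈ connectedSubgraphs K ∧ f i ∈ H.verts :=
    and_assoc.symm
  rw [hcs, h.connectedSubgraphs_eq i]
  constructor
  · rintro ⟨rfl | ⟨⟨k, t⟩, hp, rfl⟩, hi⟩
    · exact .inl rfl
    refine .inr ⟨⟨k, t⟩, ?_, rfl⟩
    simp only [Finset.coe_sigma, Set.mem_sigma_iff, Finset.coe_range, Set.mem_Iio] at hp ⊢
    refine ⟨hp.1, ?_⟩
    obtain ⟨j, hj, hij⟩ := hi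
    dsimp only at hj hij
    have hij := h.injective hij
    have := natCast_inj_of_lt hp.2 (by omega) (show (t : ZMod n) = j by linear_combination hij)
    omega
  · rintro (rfl | ⟨⟨k, t⟩, hp, rfl⟩)
    · exact ⟨.inl rfl, by rw [h.verts_eq]; exact ⟨i, rfl⟩⟩
    simp only [Finset.coe_sigma, Set.mem_sigma_iff, Finset.coe_range, Set.mem_Iio] at hp
    refine ⟨.inr ⟨⟨k, t⟩, ?_, rfl⟩, t, by dsimp only; omega, by simp⟩
    simp only [Finset.coe_sigma, Set.mem_sigma_iff, Finset.coe_range, Set.mem_Iio]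
    omega

lemma notMem_arcBefore_image (h : IsCycleMap n K f) (i : ZMod n) {A : Finset (Σ _ : ℕ, ℕ)}
    (hA : A ⊆ (Finset.range n).sigma fun _ => Finset.range n) :
    K ∉ h.arcBefore i '' A := by
  rintro ⟨p, hp, heq⟩
  have := hA hp
  simp only [Finset.mem_sigma, Finset.mem_range] at this
  exact h.ne_arc _ this.1 heq.symm

theorem ncard_connectedSubgraphs [Finite V] (h : IsCycleMap n K f) :
    (connectedSubgraphs K).ncard = n ^ 2 + 1 := by
  rw [h.connectedSubgraphs_eq 0,
    Set.ncard_insert_of_notMem (h.notMem_arcBefore_image 0 subset_rfl) (Set.toFinite _),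
    (h.arcBefore_injOn 0).ncard_image, Set.ncard_coe_finset, Finset.card_sigma]
  simp [sq]

theorem ncard_connectedSubgraphsAt [Finite V] (h : IsCycleMap n K f) {x : V} (hx : x ∈ K.verts) :
    2 * (connectedSubgraphsAt K x).ncard = n * (n + 1) + 2 := by
  rw [h.verts_eq] at hx
  obtain ⟨i, rfl⟩ := hx
  have hsub : ((Finset.range n).sigma fun k => Finset.range (k + 1)) ⊆
      (Finset.range n).sigma fun _ => Finset.range n := by
    rintro ⟨k, t⟩
    simp only [Finset.mem_sigma, Finset.mem_range]
    omega
  rw [h.connectedSubgraphsAt_eq i,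
    Set.ncard_insert_of_notMem (h.notMem_arcBefore_image i hsub) (Set.toFinite _),
    ((h.arcBefore_injOn i).mono (by exact_mod_cast hsub)).ncard_image,
    Set.ncard_coe_finset, Finset.card_sigma]
  simp only [Finset.card_range]
  -- Shifting the index turns the sum of `k + 1` over `k < n` into the sum of `k` over `k < n + 1`.
  have := Finset.sum_range_succ' (fun k => k) n
  have h2 := Finset.sum_range_id_mul_two (n + 1)
  simp only [add_tsub_cancel_right] at h2
  rw [this] at h2
  linarith

end IsCycleMap

/-! ### Attaching a leaf -/

/-- `K` together with the edge from `w` to `v`. -/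
def attach (K : G.Subgraph) {w v : V} (h : G.Adj w v) : G.Subgraph := K ⊔ G.subgraphOfAdj h

section attach

variable {K H : G.Subgraph} {w v x : V} {h : G.Adj w v}

lemma attach_verts : (attach K h).verts = K.verts ∪ {w, v} := rfl

lemma attach_verts_of_mem (hw : w ∈ K.verts) : (attach K h).verts = insert v K.verts := by
  ext y
  simp only [attach_verts, Set.mem_union, Set.mem_insert_iff, Set.mem_singleton_iff]
  constructor
  · rintro (hy | rfl | rfl)
    exacts [.inr hy, .inr hw, .inl rfl]
  · rintro (rfl | hy)
    exacts [.inr (.inr rfl), .inl hy]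

lemma attach_adj {a b : V} :
    (attach K h).Adj a b ↔ K.Adj a b ∨ (a = w ∧ b = v) ∨ (a = v ∧ b = w) := by
  simp only [attach, Subgraph.sup_adj, subgraphOfAdj_adj, Sym2.eq_iff]
  constructor <;> rintro (h | ⟨rfl, rfl⟩ | ⟨rfl, rfl⟩) <;> simp_all

lemma le_attach : K ≤ attach K h := le_sup_left

lemma attach_mono (hle : H ≤ K) : attach H h ≤ attach K h := sup_le_sup_right hle _

lemma attach_connected (hK : K.Connected) (hw : w ∈ K.verts) : (attach K h).Connected :=
  Subgraph.connected_sup hK.preconnected (Subgraph.subgraphOfAdj_connected h).preconnected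
    ⟨w, hw, by simp⟩

lemma adj_of_attach (hv : v ∉ K.verts) {y : V} (hy : (attach K h).Adj v y) : y = w := by
  rcases attach_adj.1 hy with h1 | ⟨h1, -⟩ | ⟨-, h1⟩
  · exact absurd (K.edge_vert h1) hv
  · exact absurd h1.symm h.ne
  · exact h1

lemma le_of_le_attach (hv : v ∉ K.verts) (hw : w ∈ K.verts) (hle : H ≤ attach K h)
    (hvH : v ∉ H.verts) : H ≤ K := by
  refine ⟨fun y hy => ?_, fun a b hab => ?_⟩
  · have := hle.1 hy
    rw [attach_verts_of_mem hw] at this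
    rcases this with rfl | this
    exacts [absurd hy hvH, this]
  · rcases attach_adj.1 (hle.2 hab) with h1 | ⟨-, rfl⟩ | ⟨rfl, -⟩
    · exact h1
    · exact absurd (H.edge_vert hab.symm) hvH
    · exact absurd (H.edge_vert hab) hvH

/-- Since `v` lies outside `K`, deleting it recovers `H` from `attach H h`. -/
lemma attach_injOn (hv : v ∉ K.verts) :
    Set.InjOn (fun H => attach H h) (connectedSubgraphsAt K w) := by
  have key : ∀ {A B : G.Subgraph}, A ∈ connectedSubgraphsAt K w → B ∈ connectedSubgraphsAt K w →
      attach A h = attach B h → A ≤ B := by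
    rintro A B ⟨hA, -, -⟩ ⟨hB, -, hwB⟩ heq
    refine le_of_le_attach (h := h) (fun hvB => hv (hB.1 hvB)) hwB ?_ fun hvA => hv (hA.1 hvA)
    exact heq ▸ le_attach
  exact fun A hA B hB heq => le_antisymm (key hA hB heq) (key hB hA heq.symm)

/-- The only edge at `v` is the one to `w`. A connected subgraph through `v` either avoids it and is
a single vertex, or uses it and stays connected, with `w` in it, when `v` is removed. -/
lemma connectedSubgraphsAt_attach_leaf (hw : w ∈ K.verts) (hv : v ∉ K.verts) :
    connectedSubgraphsAt (attach K h) v =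
      insert (G.singletonSubgraph v) ((fun H => attach H h) '' connectedSubgraphsAt K w) := by
  ext H
  constructor
  · rintro ⟨hle, hH, hvH⟩
    by_cases hwv : H.Adj w v
    · have hHK : H = attach (H ⊓ K) h := by
        refine le_antisymm (And.intro ?_ ?_) (sup_le inf_le_left ?_)
        · intro y hy
          have := hle.1 hy
          rw [attach_verts_of_mem hw] at this
          rcases this with rfl | this
          · exact .inr (.inr rfl)
          · exact .inl ⟨hy, this⟩
        · intro a b hab
          rcases attach_adj.1 (hle.2 hab) with h1 | h1
          · exact attach_adj.2 (.inl ⟨hab, h1⟩)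
          · exact attach_adj.2 (.inr h1)
        · exact subgraphOfAdj_le_of_adj H hwv
      refine .inr ⟨H ⊓ K, ⟨inf_le_right, ?_, ⟨H.edge_vert hwv, hw⟩⟩, hHK.symm⟩
      refine connected_of_closed (a := w) ⟨H.edge_vert hwv, hw⟩ fun S hS hcl => ?_
      -- A set closed in `H ⊓ K` and containing `w` becomes closed in `H` once `v` is added.
      have := verts_subset_of_closed (S := insert v S) hH (H.edge_vert hwv) (.inr hS) (by
        rintro x y (rfl | hx) hxy
        · exact .inr ((adj_of_attach hv (hle.2 hxy)) ▸ hS)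
        · rcases attach_adj.1 (hle.2 hxy) with h1 | ⟨-, rfl⟩ | ⟨-, rfl⟩
          · exact .inr (hcl _ _ hx ⟨hxy, h1⟩)
          · exact .inl rfl
          · exact .inr hS)
      rintro y ⟨hyH, hyK⟩
      rcases this hyH with rfl | hy
      exacts [absurd hyK hv, hy]
    · refine .inl ?_
      rw [eq_singletonSubgraph_iff_verts_eq]
      refine Set.Subset.antisymm ?_ (by simpa using hvH)
      refine verts_subset_of_closed hH hvH rfl ?_
      rintro x y rfl hxy
      have := adj_of_attach hv (hle.2 hxy)
      subst this
      exact absurd hxy.symm hwv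
  · rintro (rfl | ⟨H, ⟨hle, hH, hwH⟩, rfl⟩)
    · refine ⟨?_, Subgraph.singletonSubgraph_connected, rfl⟩
      rw [singletonSubgraph_le_iff]
      exact .inr (.inr rfl)
    · exact ⟨attach_mono hle, attach_connected hH hwH, .inr (.inr rfl)⟩

theorem ncard_connectedSubgraphsAt_attach_leaf [Finite V] (hw : w ∈ K.verts) (hv : v ∉ K.verts) :
    (connectedSubgraphsAt (attach K h) v).ncard = (connectedSubgraphsAt K w).ncard + 1 := by
  rw [connectedSubgraphsAt_attach_leaf hw hv, Set.ncard_insert_of_notMem _ (Set.toFinite _),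
    (attach_injOn hv).ncard_image]
  rintro ⟨H, -, heq⟩
  have : w ∈ (G.singletonSubgraph v).verts := by rw [← heq]; exact .inr (.inl rfl)
  exact h.ne this

theorem ncard_connectedSubgraphs_attach [Finite V] (hw : w ∈ K.verts) (hv : v ∉ K.verts) :
    (connectedSubgraphs (attach K h)).ncard =
      (connectedSubgraphs K).ncard + (connectedSubgraphsAt K w).ncard + 1 := by
  have hunion : connectedSubgraphs (attach K h) =
      connectedSubgraphs K ∪ connectedSubgraphsAt (attach K h) v := by
    ext H
    constructor
    · rintro ⟨hle, hH⟩
      by_cases hvH : v ∈ H.verts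
      · exact .inr ⟨hle, hH, hvH⟩
      · exact .inl ⟨le_of_le_attach hv hw hle hvH, hH⟩
    · rintro (⟨hle, hH⟩ | ⟨hle, hH, -⟩)
      exacts [⟨hle.trans le_attach, hH⟩, ⟨hle, hH⟩]
  have hdisj : Disjoint (connectedSubgraphs K) (connectedSubgraphsAt (attach K h) v) :=
    Set.disjoint_left.2 fun H hH hH' => hv (hH.1.1 hH'.2.2)
  rw [hunion, Set.ncard_union_eq hdisj (Set.toFinite _) (Set.toFinite _),
    ncard_connectedSubgraphsAt_attach_leaf hw hv, add_assoc]

/-- The two new subgraphs are `attach T h` and `attach K h`. A gain of 2, not just 1, is what rules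
out equality at old vertices in `le_ncard_at`. -/
lemma ncard_connectedSubgraphsAt_attach_of_mem [Finite V] (hw : w ∈ K.verts) (hv : v ∉ K.verts)
    (hx : x ∈ K.verts) (hK : K.Connected) {T : G.Subgraph} (hle : T ≤ K) (hne : T ≠ K)
    (hT : T.Connected) (hverts : T.verts = K.verts) :
    (connectedSubgraphsAt K x).ncard + 2 ≤ (connectedSubgraphsAt (attach K h) x).ncard := by
  have hne' : attach T h ≠ attach K h := fun heq =>
    hne (attach_injOn (h := h) hv ⟨hle, hT, by rwa [hverts]⟩ ⟨le_rfl, hK, hw⟩ heq)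
  have hdisj : Disjoint (connectedSubgraphsAt K x) {attach T h, attach K h} := by
    refine Set.disjoint_left.2 ?_
    rintro H ⟨hH, -, -⟩ (rfl | rfl) <;> exact hv (hH.1 (.inr (.inr rfl)))
  rw [← Set.ncard_pair hne', ← Set.ncard_union_eq hdisj (Set.toFinite _) (Set.toFinite _)]
  refine Set.ncard_le_ncard ?_ (Set.toFinite _)
  rintro H (⟨hH, hc, hxH⟩ | rfl | rfl)
  · exact ⟨hH.trans le_attach, hc, hxH⟩
  · exact ⟨attach_mono hle, attach_connected hT (by rwa [hverts]), .inl (by rwa [hverts])⟩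
  · exact ⟨le_rfl, attach_connected hK hw, .inl hx⟩

lemma edgeSet_attach : (attach K h).edgeSet = insert s(w, v) K.edgeSet := by
  rw [attach, Subgraph.edgeSet_sup, edgeSet_subgraphOfAdj, Set.union_singleton]

end attach

/-! ### Counting in unicyclic graphs and lollipops -/

/-- `K` is a connected graph with `n` vertices and `n` edges: a cycle to which leaves are
attached one after the other. -/
inductive IsUnicyclicSub : ℕ → G.Subgraph → Prop
  | cycle {n : ℕ} {K : G.Subgraph} {f : ZMod n → V} (hf : IsCycleMap n K f) : IsUnicyclicSub n K
  | attach {n : ℕ} {K : G.Subgraph} {w v : V} (h : G.Adj w v) (hK : IsUnicyclicSub n K)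
      (hw : w ∈ K.verts) (hv : v ∉ K.verts) : IsUnicyclicSub (n + 1) (attach K h)

/-- `K` is a lollipop with `n` vertices, whose head is a triangle and whose tail ends at the
given vertex. -/
inductive IsLollipopSub : ℕ → G.Subgraph → V → Prop
  | triangle {K : G.Subgraph} {f : ZMod 3 → V} {v : V} (hf : IsCycleMap 3 K f)
      (hv : v ∈ K.verts) : IsLollipopSub 3 K v
  | attach {n : ℕ} {K : G.Subgraph} {w v : V} (h : G.Adj w v) (hK : IsLollipopSub n K w)
      (hv : v ∉ K.verts) : IsLollipopSub (n + 1) (attach K h) v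

lemma IsLollipopSub.mem {n : ℕ} {K : G.Subgraph} {v : V} (hK : IsLollipopSub n K v) :
    v ∈ K.verts := by
  cases hK with
  | triangle hf hv => exact hv
  | attach h hK hv => exact .inr (.inr rfl)

lemma IsLollipopSub.isUnicyclicSub {n : ℕ} {K : G.Subgraph} {v : V} (hK : IsLollipopSub n K v) :
    IsUnicyclicSub n K := by
  induction hK with
  | triangle hf hv => exact .cycle hf
  | attach h hK hv ih => exact .attach h ih hK.mem hv

theorem IsLollipopSub.ncard_at [Finite V] {n : ℕ} {K : G.Subgraph} {v : V}
    (hK : IsLollipopSub n K v) : (connectedSubgraphsAt K v).ncard = n + 4 := by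
  induction hK with
  | triangle hf hv => have := hf.ncard_connectedSubgraphsAt hv; omega
  | attach h hK hv ih => rw [ncard_connectedSubgraphsAt_attach_leaf hK.mem hv, ih]

theorem IsLollipopSub.ncard [Finite V] {n : ℕ} {K : G.Subgraph} {v : V}
    (hK : IsLollipopSub n K v) : 2 * (connectedSubgraphs K).ncard + 16 = n ^ 2 + 9 * n := by
  induction hK with
  | triangle hf hv => rw [hf.ncard_connectedSubgraphs]; norm_num
  | attach h hK hv ih => rw [ncard_connectedSubgraphs_attach hK.mem hv, hK.ncard_at]; linarith

namespace IsUnicyclicSub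

variable {n : ℕ} {K : G.Subgraph}

lemma three_le (hK : IsUnicyclicSub n K) : 3 ≤ n := by
  induction hK with
  | cycle hf => exact hf.three_le
  | attach => omega

lemma connected (hK : IsUnicyclicSub n K) : K.Connected := by
  induction hK with
  | cycle hf => exact hf.connected
  | attach h hK hw hv ih => exact attach_connected ih hw

lemma ncard_verts [Finite V] (hK : IsUnicyclicSub n K) : K.verts.ncard = n := by
  induction hK with
  | cycle hf =>
    rw [hf.verts_eq, ← Set.image_univ, Set.ncard_image_of_injective _ hf.injective,
      Set.ncard_univ, Nat.card_zmod]
  | attach h hK hw hv ih =>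
    rw [attach_verts_of_mem hw, Set.ncard_insert_of_notMem hv (Set.toFinite _), ih]

lemma ncard_edgeSet [Finite V] (hK : IsUnicyclicSub n K) : K.edgeSet.ncard = n := by
  induction hK with
  | @cycle n K f hf =>
    have h3 := hf.three_le
    have hrange : K.edgeSet = Set.range fun i => s(f i, f (i + 1)) := by
      ext e
      induction e using Sym2.ind with
      | _ x y =>
        rw [Subgraph.mem_edgeSet, hf.adj_iff]
        simp only [Set.mem_range, Sym2.eq_iff]
        refine exists_congr fun i => ?_
        constructor <;> rintro (⟨h1, h2⟩ | ⟨h1, h2⟩) <;> simp [h1, h2]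
    have hinj : Function.Injective fun i => s(f i, f (i + 1)) := by
      intro i j hij
      rcases Sym2.eq_iff.1 hij with ⟨h1, -⟩ | ⟨h1, h2⟩
      · exact hf.injective h1
      · have h1 := hf.injective h1
        have h2 := hf.injective h2
        have : ((2 : ℕ) : ZMod n) = (0 : ℕ) := by push_cast; linear_combination h2 - h1
        have := natCast_inj_of_lt (by omega) (by omega) this
        omega
    rw [hrange, ← Set.image_univ, Set.ncard_image_of_injective _ hinj, Set.ncard_univ,
      Nat.card_zmod]
  | attach h hK hw hv ih =>
    rw [edgeSet_attach, Set.ncard_insert_of_notMem _ (Set.toFinite _), ih]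
    intro hmem
    exact hv (Subgraph.edge_vert _ (Subgraph.adj_symm _ hmem))

/-- In the cycle an edge is dropped, leaving the arc with `n - 1` edges; attached leaves are then
carried along. -/
lemma exists_spanning (hK : IsUnicyclicSub n K) :
    ∃ T ≤ K, T ≠ K ∧ T.Connected ∧ T.verts = K.verts := by
  induction hK with
  | cycle hf =>
    exact ⟨_, hf.arc_le 0 _, (hf.ne_arc 0 (by have := hf.three_le; omega)).symm,
      IsCycleMap.arc_connected _ _ _, hf.verts_arc_pred 0⟩
  | attach h hK hw hv ih =>
    obtain ⟨T, hle, hne, hT, hverts⟩ := ih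
    refine ⟨CoreIndex.attach T h, attach_mono hle, fun heq => hne ?_,
      attach_connected hT (by rwa [hverts]), by rw [attach_verts, attach_verts, hverts]⟩
    exact attach_injOn (h := h) hv ⟨hle, hT, by rwa [hverts]⟩ ⟨le_rfl, hK.connected, hw⟩ heq

theorem le_ncard_at [Finite V] (hK : IsUnicyclicSub n K) {x : V} (hx : x ∈ K.verts) :
    n + 4 ≤ (connectedSubgraphsAt K x).ncard ∧
      ((connectedSubgraphsAt K x).ncard = n + 4 → IsLollipopSub n K x) := by
  induction hK generalizing x with
  | @cycle n K f hf =>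
    have h3 := hf.three_le
    have hcard := hf.ncard_connectedSubgraphsAt hx
    rcases h3.eq_or_lt with rfl | h4
    · exact ⟨by omega, fun _ => .triangle hf hx⟩
    -- For a cycle the count is `n * (n + 1) / 2 + 1`, which exceeds `n + 4` from `n = 4` on.
    · have : n + 4 < (connectedSubgraphsAt K x).ncard := by nlinarith
      exact ⟨this.le, fun heq => absurd heq this.ne'⟩
  | @attach n K w v h hK hw hv ih =>
    by_cases hxK : x ∈ K.verts
    · obtain ⟨T, hle, hne, hT, hverts⟩ := hK.exists_spanning
      have := ncard_connectedSubgraphsAt_attach_of_mem (h := h) hw hv hxK hK.connected hle hne hT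
        hverts
      have := (ih hxK).1
      exact ⟨by omega, fun heq => by omega⟩
    · rw [attach_verts_of_mem hw] at hx
      obtain rfl := hx.resolve_right hxK
      rw [ncard_connectedSubgraphsAt_attach_leaf hw hv]
      obtain ⟨h1, h2⟩ := ih hw
      exact ⟨by omega, fun heq => .attach h (h2 (by omega)) hv⟩

/-- The cycle must be split off because its count can lie below the bound. One leaf suffices to
restore it: strictly for a cycle of length at least 4, with equality allowed for a triangle, where
the result is a lollipop. -/
theorem cycle_or_le_ncard [Finite V] (hK : IsUnicyclicSub n K) :
    (∃ f, IsCycleMap n K f) ∨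
      (n ^ 2 + 9 * n ≤ 2 * (connectedSubgraphs K).ncard + 16 ∧
        (2 * (connectedSubgraphs K).ncard + 16 = n ^ 2 + 9 * n → ∃ v, IsLollipopSub n K v)) := by
  induction hK with
  | cycle hf => exact .inl ⟨_, hf⟩
  | @attach n K w v h hK hw hv ih =>
    right
    rw [ncard_connectedSubgraphs_attach hw hv]
    obtain ⟨hat, hat'⟩ := hK.le_ncard_at hw
    rcases ih with ⟨f, hf⟩ | ⟨hle, -⟩
    · rw [hf.ncard_connectedSubgraphs]
      have h2 := hf.ncard_connectedSubgraphsAt hw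
      rcases hf.three_le.eq_or_lt with rfl | h4
      · exact ⟨by omega, fun _ => ⟨v, .attach h (.triangle hf hw) hv⟩⟩
      · have : (n + 1) ^ 2 + 9 * (n + 1) <
            2 * (n ^ 2 + 1 + (connectedSubgraphsAt K w).ncard + 1) + 16 := by nlinarith
        exact ⟨this.le, fun heq => absurd heq this.ne'⟩
    · exact ⟨by linarith, fun heq => ⟨v, .attach h (hat' (by nlinarith)) hv⟩⟩

end IsUnicyclicSub

/-! ### Unicyclic graphs as cycles with attached leaves -/

lemma connected_top_iff : (⊤ : G.Subgraph).Connected ↔ G.Connected := by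
  rw [Subgraph.connected_iff', Subgraph.topIso.connected_iff]

lemma exists_isCycleMap_of_isCycle {u : V} {c : G.Walk u u} (hc : c.IsCycle) :
    ∃ f, IsCycleMap c.length c.toSubgraph f := by
  have h3 := hc.three_le_length
  have : NeZero c.length := ⟨by omega⟩
  -- The case `i = c.length` is included: the index wraps to 0, and the closed walk is back at its
  -- start.
  have hcast : ∀ i ≤ c.length, c.getVert ((i : ℕ) : ZMod c.length).val = c.getVert i := by
    intro i hi
    rw [ZMod.val_natCast]
    rcases hi.lt_or_eq with hi | rfl
    · rw [Nat.mod_eq_of_lt hi]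
    · simp
  refine ⟨fun i => c.getVert i.val, h3, ?_, ?_, ?_⟩
  · intro i j hij
    have hi := i.val_lt
    have hj := j.val_lt
    exact ZMod.val_injective _ (hc.getVert_injOn' (by simp only [Set.mem_ofPred_eq]; omega)
      (by simp only [Set.mem_ofPred_eq]; omega) hij)
  · ext x
    rw [Walk.mem_verts_toSubgraph, Walk.mem_support_iff_exists_getVert]
    constructor
    · rintro ⟨i, rfl, hi⟩
      exact ⟨i, hcast i hi⟩
    · rintro ⟨i, rfl⟩
      exact ⟨i.val, rfl, i.val_lt.le⟩
  · intro x y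
    rw [Walk.toSubgraph_adj_iff]
    have hsucc : ∀ i : ZMod c.length, c.getVert (i + 1).val = c.getVert (i.val + 1) := by
      intro i
      rw [← hcast (i.val + 1) i.val_lt]
      simp
    simp only [hsucc, Sym2.eq_iff]
    constructor
    · rintro ⟨i, h, hi⟩
      refine ⟨i, ?_⟩
      rw [ZMod.val_natCast, Nat.mod_eq_of_lt hi]
      rcases h with ⟨h1, h2⟩ | ⟨h1, h2⟩ <;> simp [h1, h2]
    · rintro ⟨i, h⟩
      refine ⟨i.val, ?_, i.val_lt⟩
      rcases h with ⟨h1, h2⟩ | ⟨h1, h2⟩ <;> simp [h1, h2]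

/-- As long as a vertex is missing, connectedness of `G` gives an edge leaving `K`, which can be
attached. -/
lemma IsUnicyclicSub.exists_verts_eq_univ [Finite V] (hG : G.Connected) {n : ℕ}
    {K : G.Subgraph} (hK : IsUnicyclicSub n K) :
    ∃ (n' : ℕ) (K' : G.Subgraph), IsUnicyclicSub n' K' ∧ K'.verts = Set.univ := by
  induction hd : Nat.card V - n generalizing n K with
  | zero =>
    refine ⟨n, K, hK, Set.eq_of_subset_of_ncard_le (Set.subset_univ _) ?_ (Set.toFinite _)⟩
    rw [Set.ncard_univ, hK.ncard_verts]
    omega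
  | succ d ih =>
    by_cases huniv : K.verts = Set.univ
    · exact ⟨n, K, hK, huniv⟩
    obtain ⟨a, ha⟩ := hK.connected.nonempty
    obtain ⟨w, v, hw, hwv, hv⟩ : ∃ w v, w ∈ K.verts ∧ G.Adj w v ∧ v ∉ K.verts := by
      by_contra! hcon
      refine huniv (Set.univ_subset_iff.1 ?_)
      exact verts_subset_of_closed (connected_top_iff.2 hG) (Set.mem_univ a) ha
        fun x y hx hxy => hcon x y hx hxy
    exact ih (.attach hwv hK hw hv) (by omega)

theorem isUnicyclic_iff [Fintype V] :
    IsUnicyclic G ↔ IsUnicyclicSub (Fintype.card V) (⊤ : G.Subgraph) := by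
  constructor
  · rintro ⟨hconn, hcard⟩
    -- A tree would have one edge fewer than vertices.
    have hcyc : ¬ G.IsAcyclic := by
      intro hac
      have := (isTree_iff_connected_and_card.1 ⟨hconn, hac⟩).2
      rw [Nat.card_coe_set_eq, hcard, Nat.card_eq_fintype_card] at this
      omega
    simp only [IsAcyclic, not_forall, not_not] at hcyc
    obtain ⟨u, c, hc⟩ := hcyc
    obtain ⟨f, hf⟩ := exists_isCycleMap_of_isCycle hc
    obtain ⟨n, K, hK, hverts⟩ := (IsUnicyclicSub.cycle hf).exists_verts_eq_univ hconn
    have hn : n = Fintype.card V := by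
      rw [← hK.ncard_verts, hverts, Set.ncard_univ, Nat.card_eq_fintype_card]
    subst hn
    -- The spanning `K` grown from the cycle already has as many edges as `G`, so nothing is left
    -- over.
    have hedges : K.edgeSet = G.edgeSet :=
      Set.eq_of_subset_of_ncard_le K.edgeSet_subset (by rw [hcard, hK.ncard_edgeSet])
        (Set.toFinite _)
    have htop : K = ⊤ := by
      refine Subgraph.ext hverts ?_
      ext x y
      rw [← Subgraph.mem_edgeSet, hedges]
      simp
    rwa [← htop]
  · intro h
    refine ⟨connected_top_iff.1 h.connected, ?_⟩
    rw [← Subgraph.edgeSet_top, h.ncard_edgeSet]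

lemma coreIndex_eq : coreIndex G = (connectedSubgraphs (⊤ : G.Subgraph)).ncard := by
  simp [coreIndex, connectedSubgraphs]

/-! ### Recognising lollipops and cycles up to isomorphism -/

/-- The adjacency of the lollipop with a triangle, on natural numbers. -/
def LollipopRel (i j : ℕ) : Prop :=
  (i + 1 = j ∨ (i = 0 ∧ j = 2)) ∨ (j + 1 = i ∨ (j = 0 ∧ i = 2))

instance : DecidableRel LollipopRel := fun _ _ => inferInstanceAs (Decidable (_ ∨ _))

lemma lollipop_adj {n : ℕ} {i j : Fin n} :
    (lollipop n 3).Adj i j ↔ LollipopRel i j := by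
  simp only [lollipop, fromRel_adj, LollipopRel, ne_eq, Fin.ext_iff]
  omega

lemma IsCycleMap.adj_apply_iff {n : ℕ} {K : G.Subgraph} {f : ZMod n → V} (h : IsCycleMap n K f)
    (a b : ZMod n) : K.Adj (f a) (f b) ↔ b = a + 1 ∨ a = b + 1 := by
  rw [h.adj_iff]
  constructor
  · rintro ⟨i, ⟨h1, h2⟩ | ⟨h1, h2⟩⟩
    · rw [h.injective h1, h.injective h2]; exact .inl rfl
    · rw [h.injective h1, h.injective h2]; exact .inr rfl
  · rintro (rfl | rfl)
    · exact ⟨_, .inl ⟨rfl, rfl⟩⟩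
    · exact ⟨_, .inr ⟨rfl, rfl⟩⟩

lemma IsLollipopSub.exists_enumeration {n : ℕ} {K : G.Subgraph} {v : V}
    (hK : IsLollipopSub n K v) :
    ∃ f : ℕ → V, Set.InjOn f (Set.Iio n) ∧ K.verts = f '' Set.Iio n ∧ f (n - 1) = v ∧
      ∀ i < n, ∀ j < n, K.Adj (f i) (f j) ↔ LollipopRel i j := by
  induction hK with
  | triangle hf hv =>
    rename_i f v
    rw [hf.verts_eq] at hv
    obtain ⟨t, rfl⟩ := hv
    -- The tail may leave the triangle at any vertex `f t`; starting at `t + 1` puts it at index 2,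
    -- since `t + 1 + 2 = t` in `ZMod 3`.
    refine ⟨fun j => f (t + 1 + j), ?_, ?_, ?_, ?_⟩
    · intro i hi j hj hij
      exact natCast_inj_of_lt hi hj (add_left_cancel (hf.injective hij))
    · rw [hf.verts_eq]
      refine Set.Subset.antisymm ?_ ?_
      · rintro _ ⟨s, rfl⟩
        refine ⟨(s - (t + 1)).val, (s - (t + 1)).val_lt, ?_⟩
        simp
      · rintro _ ⟨j, -, rfl⟩
        exact ⟨_, rfl⟩
    · dsimp only
      congr 1
      revert t; decide
    · intro i hi j hj
      rw [hf.adj_apply_iff]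
      interval_cases i <;> interval_cases j <;> revert t <;> decide
  | @attach n K w v h hK hv ih =>
    obtain ⟨f, hinj, hverts, hlast, hadj⟩ := ih
    have h3 := hK.isUnicyclicSub.three_le
    have hlt : ∀ i < n, Function.update f n v i = f i := fun i hi =>
      Function.update_of_ne hi.ne _ _
    have hn : Function.update f n v n = v := Function.update_self _ _ _
    have hmem : ∀ i < n, f i ∈ K.verts := fun i hi => by rw [hverts]; exact ⟨i, hi, rfl⟩
    have hfv : ∀ i < n, f i ≠ v := fun i hi heq => hv (heq ▸ hmem i hi)
    have hfw : ∀ i < n, f i = w ↔ i + 1 = n := by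
      intro i hi
      rw [← hlast]
      constructor
      · intro heq
        have := hinj (Set.mem_Iio.2 hi) (Set.mem_Iio.2 (by omega)) heq
        omega
      · rintro rfl; rfl
    refine ⟨Function.update f n v, ?_, ?_, hn, ?_⟩
    · intro i hi j hj hij
      rcases (Nat.lt_succ_iff_lt_or_eq.1 hi) with hi | rfl <;>
        rcases (Nat.lt_succ_iff_lt_or_eq.1 hj) with hj | rfl
      · rw [hlt i hi, hlt j hj] at hij
        exact hinj hi hj hij
      · rw [hlt i hi, hn] at hij
        exact absurd hij (hfv i hi)
      · rw [hlt j hj, hn] at hij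
        exact absurd hij.symm (hfv j hj)
      · rfl
    · rw [attach_verts_of_mem hK.mem, hverts]
      have : Set.Iio (n + 1) = insert n (Set.Iio n) := by ext i; simp
      rw [this, Set.image_insert_eq, hn]
      congr 1
      exact Set.image_congr fun i hi => (hlt i hi).symm
    · intro i hi j hj
      rw [attach_adj]
      rcases (Nat.lt_succ_iff_lt_or_eq.1 hi) with hi | rfl <;>
        rcases (Nat.lt_succ_iff_lt_or_eq.1 hj) with hj | rfl
      · simp [hlt i hi, hlt j hj, hadj i hi j hj, hfv i hi, hfv j hj]
      · have hnK : ¬ K.Adj (f i) v := fun hab => hv (K.edge_vert hab.symm)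
        simp only [hlt i hi, hn, hnK, hfw i hi, hfv i hi, LollipopRel, false_and, and_true,
          false_or, or_false]
        omega
      · have hnK : ¬ K.Adj v (f j) := fun hab => hv (K.edge_vert hab)
        simp only [hlt j hj, hn, hnK, hfw j hj, hfv j hj, LollipopRel, and_false, true_and,
          false_or]
        omega
      · have hnK : ¬ K.Adj v v := fun hab => hv (K.edge_vert hab)
        simp only [hn, LollipopRel, hnK, h.ne', false_and, and_false, or_false, false_iff]
        omega

/-- Induction over initial segments: beyond the triangle, the only earlier neighbour of `g m` is `g
(m - 1)`, so each new vertex is a leaf at the current end of the tail. -/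
lemma isLollipopSub_induce {n : ℕ} {g : ℕ → V} (hg : Set.InjOn g (Set.Iio n))
    (hadj : ∀ i < n, ∀ j < n, G.Adj (g i) (g j) ↔ LollipopRel i j) {m : ℕ} (h3 : 3 ≤ m)
    (hm : m ≤ n) :
    IsLollipopSub m ((⊤ : G.Subgraph).induce (g '' Set.Iio m)) (g (m - 1)) := by
  induction m, h3 using Nat.le_induction with
  | base =>
    have hval : ∀ i : ZMod 3, i.val < n := fun i => i.val_lt.trans_le hm
    have hadj' : ∀ i j : ZMod 3, G.Adj (g i.val) (g j.val) ↔ j = i + 1 ∨ i = j + 1 := by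
      intro i j
      rw [hadj _ (hval i) _ (hval j)]
      revert i j
      decide
    have himage : ∀ x, x ∈ g '' Set.Iio 3 ↔ ∃ i : ZMod 3, x = g i.val := by
      intro x
      constructor
      · rintro ⟨i, hi, rfl⟩
        refine ⟨i, ?_⟩
        rw [ZMod.val_natCast, Nat.mod_eq_of_lt hi]
      · rintro ⟨i, rfl⟩
        exact ⟨_, i.val_lt, rfl⟩
    refine .triangle (f := fun i => g i.val) ⟨le_rfl, ?_, ?_, ?_⟩ ⟨2, by simp, rfl⟩
    · intro i j hij
      exact ZMod.val_injective _ (hg (hval i) (hval j) hij)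
    · ext x
      rw [Subgraph.induce_verts, himage]
      simp [eq_comm]
    · intro x y
      rw [Subgraph.induce_adj, himage, himage, Subgraph.top_adj]
      constructor
      · rintro ⟨⟨i, rfl⟩, ⟨j, rfl⟩, hij⟩
        rcases (hadj' i j).1 hij with rfl | rfl
        · exact ⟨_, .inl ⟨rfl, rfl⟩⟩
        · exact ⟨_, .inr ⟨rfl, rfl⟩⟩
      · rintro ⟨i, ⟨rfl, rfl⟩ | ⟨rfl, rfl⟩⟩
        · exact ⟨⟨_, rfl⟩, ⟨_, rfl⟩, (hadj' _ _).2 (.inl rfl)⟩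
        · exact ⟨⟨_, rfl⟩, ⟨_, rfl⟩, (hadj' _ _).2 (.inr rfl)⟩
  | succ m h3 ih =>
    have h : G.Adj (g (m - 1)) (g m) := by
      rw [hadj _ (by omega) _ (by omega), LollipopRel]; omega
    have hv : g m ∉ g '' Set.Iio m := by
      rintro ⟨i, hi, heq⟩
      have hi : i < m := hi
      have := hg (Set.mem_Iio.2 (by omega)) (Set.mem_Iio.2 (by omega)) heq
      omega
    have hins : g '' Set.Iio (m + 1) = insert (g m) (g '' Set.Iio m) := by
      rw [← Set.image_insert_eq]; congr 1; ext i; simp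
    have hw : g (m - 1) ∈ g '' Set.Iio m := ⟨m - 1, by simp; omega, rfl⟩
    have heq : (⊤ : G.Subgraph).induce (g '' Set.Iio (m + 1)) =
        attach ((⊤ : G.Subgraph).induce (g '' Set.Iio m)) h := by
      have hlast : ∀ x ∈ g '' Set.Iio m, G.Adj x (g m) → x = g (m - 1) := by
        rintro _ ⟨i, hi, rfl⟩ hi'
        have hi : i < m := hi
        rw [hadj _ (by omega) _ (by omega), LollipopRel] at hi'
        congr 1
        omega
      refine Subgraph.ext ?_ ?_
      · rw [attach_verts_of_mem (by exact hw)]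
        exact hins
      · ext x y
        rw [attach_adj, Subgraph.induce_adj, Subgraph.induce_adj, Subgraph.top_adj, hins]
        constructor
        · rintro ⟨rfl | hx, rfl | hy, hxy⟩
          · exact absurd hxy (G.irrefl)
          · exact .inr (.inr ⟨rfl, hlast _ hy hxy.symm⟩)
          · exact .inr (.inl ⟨hlast _ hx hxy, rfl⟩)
          · exact .inl ⟨hx, hy, hxy⟩
        · rintro (⟨hx, hy, hxy⟩ | ⟨rfl, rfl⟩ | ⟨rfl, rfl⟩)
          · exact ⟨.inr hx, .inr hy, hxy⟩
          · exact ⟨.inr hw, .inl rfl, h⟩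
          · exact ⟨.inl rfl, .inr hw, h.symm⟩
    rw [heq]
    exact .attach h (ih (by omega)) hv

theorem nonempty_iso_lollipop_iff {n : ℕ} (hn : 3 ≤ n) :
    Nonempty (G ≃g lollipop n 3) ↔ ∃ v, IsLollipopSub n (⊤ : G.Subgraph) v := by
  constructor
  · rintro ⟨e⟩
    -- The value outside the range is arbitrary and never used.
    let g : ℕ → V := fun i => if h : i < n then e.symm ⟨i, h⟩ else e.symm ⟨0, by omega⟩
    have hg : ∀ i (h : i < n), g i = e.symm ⟨i, h⟩ := fun i h => dif_pos h
    have huniv : g '' Set.Iio n = Set.univ := by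
      refine Set.eq_univ_of_forall fun x => ⟨e x, (e x).2, ?_⟩
      rw [hg _ (e x).2]; simp
    have := isLollipopSub_induce (G := G) (g := g) (n := n) (m := n) (by
      intro i hi j hj hij
      rw [hg i hi, hg j hj] at hij
      exact congrArg Fin.val (e.symm.injective hij)) (by
      intro i hi j hj
      rw [hg i hi, hg j hj, e.symm.map_adj_iff, lollipop_adj]) hn le_rfl
    rw [huniv] at this
    refine ⟨g (n - 1), ?_⟩
    convert this
    exact (Subgraph.induce_self_verts (G' := (⊤ : G.Subgraph))).symm
  · rintro ⟨v, hv⟩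
    obtain ⟨f, hinj, hverts, -, hadj⟩ := hv.exists_enumeration
    have hbij : Function.Bijective fun i : Fin n => f i := by
      refine ⟨fun i j hij => Fin.ext (hinj i.2 j.2 hij), fun x => ?_⟩
      obtain ⟨i, hi, rfl⟩ : x ∈ f '' Set.Iio n := hverts ▸ Set.mem_univ x
      exact ⟨⟨i, hi⟩, rfl⟩
    refine ⟨RelIso.symm ⟨Equiv.ofBijective _ hbij, ?_⟩⟩
    intro i j
    rw [lollipop_adj, ← hadj i i.2 j j.2]
    rfl

theorem nonempty_iso_cycleGraph_iff {n : ℕ} (hn : 3 ≤ n) :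
    Nonempty (G ≃g cycleGraph n) ↔ ∃ f, IsCycleMap n (⊤ : G.Subgraph) f := by
  -- In this form `ZMod n` is definitionally `Fin n`, so the adjacency of `cycleGraph` unfolds to
  -- differences in `ZMod n`.
  obtain ⟨m, rfl⟩ : ∃ m, n = m + 1 + 2 := ⟨n - 3, by omega⟩
  have hadj : ∀ i j : ZMod (m + 1 + 2),
      (cycleGraph (m + 1 + 2)).Adj i j ↔ j = i + 1 ∨ i = j + 1 := by
    intro i j
    have h1 : (cycleGraph (m + 1 + 2)).Adj i j ↔ i - j = 1 ∨ j - i = 1 := Iff.rfl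
    rw [h1, sub_eq_iff_eq_add, sub_eq_iff_eq_add, add_comm 1 j, add_comm 1 i, or_comm]
  constructor
  · rintro ⟨e⟩
    let e' : V ≃ ZMod (m + 1 + 2) := e.toEquiv
    have hadj' : ∀ x y, G.Adj x y ↔ e' y = e' x + 1 ∨ e' x = e' y + 1 := fun x y =>
      e.map_adj_iff.symm.trans (hadj _ _)
    refine ⟨e'.symm, hn, e'.symm.injective, e'.symm.surjective.range_eq.symm, ?_⟩
    intro x y
    rw [Subgraph.top_adj, hadj']
    constructor
    · rintro (h | h)
      · exact ⟨e' x, .inl ⟨by simp, by rw [← h]; simp⟩⟩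
      · exact ⟨e' y, .inr ⟨by simp, by rw [← h]; simp⟩⟩
    · rintro ⟨i, ⟨rfl, rfl⟩ | ⟨rfl, rfl⟩⟩
      · exact .inl (by simp)
      · exact .inr (by simp)
  · rintro ⟨f, hf⟩
    have hbij : Function.Bijective f :=
      ⟨hf.injective, Set.range_eq_univ.1 hf.verts_eq.symm⟩
    refine ⟨RelIso.symm ⟨Equiv.ofBijective _ hbij, ?_⟩⟩
    intro i j
    refine Iff.trans ?_ (hadj i j).symm
    exact hf.adj_apply_iff i j

/-! ### Core indices and the comparison -/

lemma coreIndex_of_iso_lollipop [Finite V] {n : ℕ} (hn : 3 ≤ n)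
    (h : Nonempty (G ≃g lollipop n 3)) : 2 * coreIndex G + 16 = n ^ 2 + 9 * n := by
  obtain ⟨v, hv⟩ := (nonempty_iso_lollipop_iff hn).1 h
  rw [coreIndex_eq, hv.ncard]

lemma coreIndex_of_iso_cycleGraph [Finite V] {n : ℕ} (hn : 3 ≤ n)
    (h : Nonempty (G ≃g cycleGraph n)) : coreIndex G = n ^ 2 + 1 := by
  obtain ⟨f, hf⟩ := (nonempty_iso_cycleGraph_iff hn).1 h
  rw [coreIndex_eq, hf.ncard_connectedSubgraphs]

theorem IsUnicyclic.iso_cycleGraph_or_le [Fintype V] {n : ℕ} (hcard : Fintype.card V = n)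
    (hG : IsUnicyclic G) :
    Nonempty (G ≃g cycleGraph n) ∨
      (n ^ 2 + 9 * n ≤ 2 * coreIndex G + 16 ∧
        (2 * coreIndex G + 16 = n ^ 2 + 9 * n → Nonempty (G ≃g lollipop n 3))) := by
  rw [isUnicyclic_iff, hcard] at hG
  rw [nonempty_iso_lollipop_iff hG.three_le, nonempty_iso_cycleGraph_iff hG.three_le, coreIndex_eq]
  exact hG.cycle_or_le_ncard

end CoreIndex

open CoreIndex in
theorem theorem4p9 (n : ℕ) (hn : 4 ≤ n) :
    CoreIndex.IsUnicyclic (CoreIndex.lollipop n 3) ∧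
    CoreIndex.IsUnicyclic (SimpleGraph.cycleGraph n) ∧
    (7 ≤ n → ∀ (V : Type u) [Fintype V] (G : SimpleGraph V),
      Fintype.card V = n → CoreIndex.IsUnicyclic G →
        CoreIndex.coreIndex (CoreIndex.lollipop n 3) ≤ CoreIndex.coreIndex G ∧
        (CoreIndex.coreIndex G = CoreIndex.coreIndex (CoreIndex.lollipop n 3) ↔
          Nonempty (G ≃g CoreIndex.lollipop n 3))) ∧
    (n ≤ 5 → ∀ (V : Type u) [Fintype V] (G : SimpleGraph V),
      Fintype.card V = n → CoreIndex.IsUnicyclic G →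
        CoreIndex.coreIndex (SimpleGraph.cycleGraph n) ≤ CoreIndex.coreIndex G ∧
        (CoreIndex.coreIndex G = CoreIndex.coreIndex (SimpleGraph.cycleGraph n) ↔
          Nonempty (G ≃g SimpleGraph.cycleGraph n))) ∧
    (n = 6 →
      CoreIndex.coreIndex (SimpleGraph.cycleGraph n) =
        CoreIndex.coreIndex (CoreIndex.lollipop n 3) ∧
      ∀ (V : Type u) [Fintype V] (G : SimpleGraph V),
        Fintype.card V = n → CoreIndex.IsUnicyclic G →
          CoreIndex.coreIndex (SimpleGraph.cycleGraph n) ≤ CoreIndex.coreIndex G ∧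
          (CoreIndex.coreIndex G = CoreIndex.coreIndex (SimpleGraph.cycleGraph n) ↔
            Nonempty (G ≃g SimpleGraph.cycleGraph n) ∨
              Nonempty (G ≃g CoreIndex.lollipop n 3))) := by
  have h3 : 3 ≤ n := by omega
  have hL := coreIndex_of_iso_lollipop h3 ⟨SimpleGraph.Iso.refl (G := lollipop n 3)⟩
  have hC := coreIndex_of_iso_cycleGraph h3 ⟨SimpleGraph.Iso.refl (G := SimpleGraph.cycleGraph n)⟩
  refine ⟨?_, ?_, ?_, ?_, ?_⟩
  · obtain ⟨v, hv⟩ := (nonempty_iso_lollipop_iff h3).1 ⟨SimpleGraph.Iso.refl (G := lollipop n 3)⟩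
    rw [isUnicyclic_iff, Fintype.card_fin]
    exact hv.isUnicyclicSub
  · obtain ⟨f, hf⟩ := (nonempty_iso_cycleGraph_iff h3).1
      ⟨SimpleGraph.Iso.refl (G := SimpleGraph.cycleGraph n)⟩
    rw [isUnicyclic_iff, Fintype.card_fin]
    exact .cycle hf
  · intro h7 V _ G hcard hG
    -- The difference of the two sides is `(n - 3) * (n - 6)`, positive for `n ≥ 7`.
    have hlt : n ^ 2 + 9 * n < 2 * (n ^ 2 + 1) + 16 := by nlinarith
    have hiso := fun h : Nonempty (G ≃g lollipop n 3) => coreIndex_of_iso_lollipop h3 h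
    rcases hG.iso_cycleGraph_or_le hcard with h | ⟨hle, heq⟩
    · have := coreIndex_of_iso_cycleGraph h3 h
      exact ⟨by omega, fun _ => by omega, fun h => by have := hiso h; omega⟩
    · exact ⟨by omega, fun _ => heq (by omega), fun h => by have := hiso h; omega⟩
  · intro h5 V _ G hcard hG
    -- Here `(n - 3) * (n - 6)` is negative, as `n` is 4 or 5; so every non-cycle lies strictly
    -- above the cycle.
    have hlt : 2 * (n ^ 2 + 1) + 16 < n ^ 2 + 9 * n := by nlinarith
    have hiso := fun h : Nonempty (G ≃g SimpleGraph.cycleGraph n) =>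
      coreIndex_of_iso_cycleGraph h3 h
    rcases hG.iso_cycleGraph_or_le hcard with h | ⟨hle, -⟩
    · have := hiso h
      exact ⟨by omega, fun _ => h, fun _ => by omega⟩
    · exact ⟨by omega, fun _ => by omega, fun h => by have := hiso h; omega⟩
  -- At `n = 6` the factor `n - 6` vanishes: cycle and lollipop both have 37 connected subgraphs.
  · rintro rfl
    refine ⟨by omega, fun V _ G hcard hG => ?_⟩
    have hiso := fun h : Nonempty (G ≃g lollipop 6 3) => coreIndex_of_iso_lollipop h3 h
    have hiso' := fun h : Nonempty (G ≃g SimpleGraph.cycleGraph 6) =>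
      coreIndex_of_iso_cycleGraph h3 h
    have hiff : Nonempty (G ≃g SimpleGraph.cycleGraph 6) ∨ Nonempty (G ≃g lollipop 6 3) →
        coreIndex G = coreIndex (SimpleGraph.cycleGraph 6) := by
      rintro (h | h)
      · have := hiso' h; omega
      · have := hiso h; omega
    rcases hG.iso_cycleGraph_or_le hcard with h | ⟨hle, heq⟩
    · have := hiso' h
      exact ⟨by omega, fun _ => .inl h, hiff⟩
    · exact ⟨by omega, fun _ => .inr (heq (by omega)), hiff⟩
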